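/- Nodes form a Poisson point process $V$ of intensity $n$ on the unit torus $\mathbb{R}^2/\mathbb{Z}^2$ (the unit square with opposite sides identified, with its Euclidean distance), and a set $A\subseteq V$ of $m=m(n)$ anchors is chosen uniformly at random among the subsets of $V$ of that size ($A=V$ if $|V|<m$). With radio range $R$, localization is the following process: $A_0=A$, and $A_{t+1}$ is obtained from $A_t$ by adding every $x\in V\setminus A_t$ that has at least three nodes of $A_t$ within distance $R$. All nodes are localized eventually if $A_t=V$ for some $t$. Let $c>0$ be a constant, let $r=r(n)>0$ with $r(n)\to 0$ as $n\to\infty$, and let $\tau=\tau(n)=\Theta(r(n))$ with $0<\tau<\frac{r}{2\sqrt 2}$ be such that $$\lim_{n\to\infty}\left(1-e^{-n\pi\tau^2}\right)^{2/r^2}=1 .$$ Suppose that for all sufficiently large $n$ $$1-\frac{e^{-m\pi r^2}-e^{-n\pi r^2}}{1-e^{-n\pi r^2}}>\frac{c}{\ln(\sqrt 2/r)} .$$ Then, with radio range $R=r+2\tau=\Theta(r)$, all nodes of $V$ are localized eventually with high probability, i.e. with probability tending to $1$ as $n\to\infty$. -/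

import Mathlib

open Real Filter Topology MeasureTheory ProbabilityTheory Asymptotics

noncomputable section

namespace IterLoc

/-- The flat unit torus: the unit square with opposite sides identified. Its `volume` is the
uniform probability measure. -/
abbrev Torus : Type := UnitAddCircle × UnitAddCircle

/-- Euclidean (flat) distance on the torus; the distance on `UnitAddCircle` is the distance
modulo `1`. -/
def torusDist (p q : Torus) : ℝ := √(dist p.1 q.1 ^ 2 + dist p.2 q.2 ^ 2)

open Classical in
/-- The set `A_t` of nodes that know their location at time `t`, for nodes at the locations `x`,
radio range `R` and anchor set `A`: `A_0 = A`, and `A_{t+1}` is obtained from `A_t` by adding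
every node outside `A_t` that has at least three nodes of `A_t` in its radio range. -/
def localizedAt {k : ℕ} (R : ℝ) (x : Fin k → Torus) (A : Finset (Fin k)) : ℕ → Finset (Fin k)
  | 0 => A
  | t + 1 => localizedAt R x A t ∪
      Finset.univ.filter fun i => i ∉ localizedAt R x A t ∧
        3 ≤ ((localizedAt R x A t).filter fun j => torusDist (x i) (x j) ≤ R).card

/-- A network: the number `k` of nodes, their locations, and the set of anchors. -/
abbrev Network : Type := Σ k : ℕ, (Fin k → Torus) × Finset (Fin k)

/-- Every node of the network is localized eventually, with radio range `R`. -/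
def AllLocalized (R : ℝ) (ω : Network) : Prop :=
  ∃ t : ℕ, localizedAt R ω.2.1 ω.2.2 t = Finset.univ

/-- The uniform distribution on the `m`-element sets of nodes, out of `k` nodes
(all nodes are anchors if there are fewer than `m` of them). -/
def anchorLaw (k m : ℕ) : PMF (Finset (Fin k)) :=
  PMF.uniformOfFinset (Finset.powersetCard (min m k) Finset.univ)
    (Finset.powersetCard_nonempty.2 (by simp))

/-- The law of the random network: the nodes form a Poisson point process of intensity `n` on the
unit torus (a Poisson number, of mean `n`, of independent uniform points), and the `m` anchors are
chosen uniformly among the nodes. -/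
def networkLaw (n m : ℕ) : Measure Network :=
  Measure.sum fun k : ℕ =>
    poissonMeasure (n : NNReal) {k} •
      ((volume : Measure (Fin k → Torus)).prod (anchorLaw k m).toMeasure).map
        (fun a => (⟨k, a⟩ : Network))

end IterLoc

end

/-!
The torus is cut into `N × N` square cells of side `1 / N`, where `N = ⌈√5 / R⌉`. Two points in
cells that are equal or share a side are then within the radio range `R`, so a cell all of whose
nodes are localized, and which has at least three of them, localizes every node of the cells next
to it. Hence everything is localized as soon as every cell holds three nodes and some cell holds
three anchors (`allLocalized_of_cells`).

*Every cell holds three nodes.* The number of nodes in a cell is Poisson with mean `n / N ^ 2`, and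
Chernoff's bound (`volume_cell_sparse_le`, averaged over the number of nodes by
`tsum_poisson_mul_pow`) gives at most `49 / 4 * exp (-(5 / 7) * n / N ^ 2)` for the probability of
fewer than three. Since `τ < r / (2 √2)`, the range `R = r + 2 τ` exceeds `(2 + 2 √2) τ`, and a cell
has at least `7 / 5` times the area of a disc of radius `τ` once `r` is small; so this probability is
`O(exp (-n π τ ^ 2))`. There are `O(1 / r ^ 2)` cells, and the covering hypothesis forces
`exp (-n π τ ^ 2) / r ^ 2` to tend to zero (`tendsto_exp_div_sq`).

*Some cell holds three anchors.* Given which nodes are the anchors, their locations are independent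
and uniform. The hypothesis on `m` forces `m` to be at least of order `1 / (r ^ 2 log (1 / r))`
(`lt_anchors`), which is well above the `(N ^ 2) ^ (2 / 3)` points at which three of them are likely
to share one of `N ^ 2` cells; the latter is a second moment computation for the triples with one
point in each of three disjoint groups (`card_tripleCount_eq_zero_le`). A single such cell starts
the process, so the constant `c` may be arbitrarily small.
-/

noncomputable section

namespace IterLoc

/-! ### The localization process -/

section Localization

variable {k : ℕ} {R : ℝ} {x : Fin k → Torus} {A : Finset (Fin k)}

theorem monotone_localizedAt : Monotone (localizedAt R x A) :=
  monotone_nat_of_le_succ fun t => by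
    rw [localizedAt]
    exact Finset.subset_union_left

/-- On finitely many nodes the process reaches a state containing every node that has three
members of that state in its range. -/
theorem exists_localizedAt_closed (R : ℝ) (x : Fin k → Torus) (A : Finset (Fin k)) :
    ∃ t, A ⊆ localizedAt R x A t ∧ ∀ i, ∀ s ⊆ localizedAt R x A t, 3 ≤ s.card →
      (∀ j ∈ s, torusDist (x i) (x j) ≤ R) → i ∈ localizedAt R x A t := by
  classical
  obtain ⟨t, ht⟩ := WellFoundedGT.monotone_chain_condition
    ⟨localizedAt R x A, monotone_localizedAt⟩
  refine ⟨t, monotone_localizedAt (Nat.zero_le t), fun i s hs h3 hR => ?_⟩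
  have h := ht (t + 1) (Nat.le_succ t)
  simp only [OrderHom.coe_mk] at h
  by_contra hi
  refine hi ?_
  rw [h, localizedAt, Finset.mem_union]
  refine Or.inr (Finset.mem_filter.2 ⟨Finset.mem_univ _, hi, h3.trans (Finset.card_le_card ?_)⟩)
  intro j hj
  exact Finset.mem_filter.2 ⟨hs hj, hR j hj⟩

theorem measurable_localizedAt (R : ℝ) (A : Finset (Fin k)) (t : ℕ) :
    Measurable fun x : Fin k → Torus => localizedAt R x A t := by
  classical
  induction t with
  | zero => exact measurable_const
  | succ t ih =>
    have h : ∀ i j, MeasurableSet {x : Fin k → Torus | torusDist (x i) (x j) ≤ R} := fun i j =>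
      measurableSet_le (by unfold torusDist; fun_prop) measurable_const
    -- the next state is a function of the present one and of the adjacency relation of the nodes
    let adj : (Fin k → Torus) → Fin k → Fin k → Prop := fun x i j => torusDist (x i) (x j) ≤ R
    have hadj : Measurable adj := measurable_pi_lambda _ fun i => measurable_pi_lambda _ fun j =>
      measurableSet_setOfPred.1 (h i j)
    let F : Finset (Fin k) × (Fin k → Fin k → Prop) → Finset (Fin k) := fun q =>
      q.1 ∪ Finset.univ.filter fun i => i ∉ q.1 ∧ 3 ≤ (q.1.filter fun j => q.2 i j).card
    have hF : Measurable F := .of_discrete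
    convert! hF.comp (ih.prodMk hadj) using 1

theorem measurableSet_allLocalized (R : ℝ) :
    MeasurableSet {a : (Fin k → Torus) × Finset (Fin k) | AllLocalized R ⟨k, a⟩} := by
  have h : MeasurableSet {a : (Fin k → Torus) × Finset (Fin k) |
      ∃ t, localizedAt R a.1 a.2 t = Finset.univ} := by
    rw [Set.ofPred_exists]
    refine .iUnion fun t => ?_
    exact (measurable_from_prod_countable_left
      (f := fun a : (Fin k → Torus) × Finset (Fin k) => localizedAt R a.1 a.2 t)
      fun A => measurable_localizedAt R A t) (measurableSet_singleton _)
  exact h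

end Localization

/-! ### The grid of cells -/

section Grid

instance : IsProbabilityMeasure (volume : Measure UnitAddCircle) :=
  ⟨UnitAddCircle.measure_univ⟩

instance : IsProbabilityMeasure (volume : Measure Torus) :=
  inferInstanceAs (IsProbabilityMeasure ((volume : Measure UnitAddCircle).prod volume))

variable (N : ℕ) [NeZero N]

/-- The index `j` of the arc `(j / N, (j + 1) / N]` of the unit circle that contains `x`. -/
def arc (x : UnitAddCircle) : Fin N :=
  ⟨⌈(N : ℝ) * (AddCircle.measurableEquivIoc (1 : ℝ) 0 x : ℝ)⌉₊ - 1, by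
    have hN : 0 < N := NeZero.pos N
    have h := (AddCircle.measurableEquivIoc (1 : ℝ) 0 x).2.2
    have : ⌈(N : ℝ) * (AddCircle.measurableEquivIoc (1 : ℝ) 0 x : ℝ)⌉₊ ≤ N := by
      rw [Nat.ceil_le]
      have : (0 : ℝ) < N := by exact_mod_cast hN
      nlinarith
    omega⟩

theorem measurable_arc : Measurable (arc N) := by
  refine measurable_to_countable' fun j => ?_
  have h : Measurable fun x : UnitAddCircle =>
      ⌈(N : ℝ) * (AddCircle.measurableEquivIoc (1 : ℝ) 0 x : ℝ)⌉₊ - 1 := by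
    fun_prop
  convert h (measurableSet_singleton (j : ℕ)) using 1
  ext x
  simp [arc, Fin.ext_iff]

variable {N}

theorem exists_coe_of_arc_eq {x : UnitAddCircle} {j : Fin N} (h : arc N x = j) :
    ∃ t : ℝ, x = t ∧ (j : ℝ) < N * t ∧ N * t ≤ j + 1 := by
  set u : Set.Ioc (0 : ℝ) (0 + 1) := AddCircle.measurableEquivIoc (1 : ℝ) 0 x with hu
  have hN : (0 : ℝ) < N := by exact_mod_cast NeZero.pos N
  have hpos : 0 < (N : ℝ) * u := mul_pos hN u.2.1
  have hc : 1 ≤ ⌈(N : ℝ) * u⌉₊ := Nat.one_le_ceil_iff.2 hpos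
  have hj : (j : ℕ) + 1 = ⌈(N : ℝ) * u⌉₊ := by
    rw [← h]
    simp only [arc, ← hu]
    omega
  refine ⟨u, ((AddCircle.equivIoc (1 : ℝ) 0).symm_apply_apply x).symm, ?_, ?_⟩
  · refine Nat.lt_ceil.1 (by omega)
  · exact_mod_cast (Nat.le_ceil ((N : ℝ) * u)).trans (by rw [← hj])

theorem arc_coe_eq_iff {t : ℝ} (ht : t ∈ Set.Ioc (0 : ℝ) 1) (j : Fin N) :
    arc N (t : UnitAddCircle) = j ↔ t ∈ Set.Ioc ((j : ℝ) / N) ((j + 1) / N) := by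
  have hN : (0 : ℝ) < N := by exact_mod_cast NeZero.pos N
  have hu : (AddCircle.measurableEquivIoc (1 : ℝ) 0 (t : UnitAddCircle) : ℝ) = t := by
    have h := AddCircle.equivIoc_coe_of_mem (p := (1 : ℝ)) (a := 0) (y := t) (by simpa using ht)
    exact h
  have hc : 1 ≤ ⌈(N : ℝ) * t⌉₊ := Nat.one_le_ceil_iff.2 (mul_pos hN ht.1)
  rw [Fin.ext_iff, Set.mem_Ioc, div_lt_iff₀ hN, le_div_iff₀ hN, mul_comm t]
  simp only [arc, hu]
  have h1 : (j : ℝ) < N * t ↔ (j : ℕ) < ⌈(N : ℝ) * t⌉₊ := Nat.lt_ceil.symm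
  have h2 : N * t ≤ (j : ℝ) + 1 ↔ ⌈(N : ℝ) * t⌉₊ ≤ (j : ℕ) + 1 := by
    rw [Nat.ceil_le]; push_cast; rfl
  rw [h1, h2]
  omega

theorem volume_arc_preimage (j : Fin N) :
    volume (arc N ⁻¹' {j}) = ((N : ENNReal))⁻¹ := by
  have hN : (0 : ℝ) < N := by exact_mod_cast NeZero.pos N
  rw [← (UnitAddCircle.measurePreserving_mk 0).measure_preimage
    (measurable_arc N (measurableSet_singleton j)).nullMeasurableSet,
    Measure.restrict_apply' measurableSet_Ioc]
  have h : (QuotientAddGroup.mk ⁻¹' (arc N ⁻¹' {j}) ∩ Set.Ioc (0 : ℝ) (0 + 1)) =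
      Set.Ioc ((j : ℝ) / N) ((j + 1) / N) := by
    ext t
    have hj : ((j : ℕ) : ℝ) + 1 ≤ N := by exact_mod_cast j.2
    rw [zero_add]
    constructor
    · rintro ⟨h1, h2⟩
      exact (arc_coe_eq_iff h2 j).1 h1
    · intro h
      have h2 : t ∈ Set.Ioc (0 : ℝ) 1 :=
        ⟨lt_of_le_of_lt (by positivity) h.1, h.2.trans (by rwa [div_le_one hN])⟩
      exact ⟨(arc_coe_eq_iff h2 j).2 h, h2⟩
  rw [h, Real.volume_Ioc, ← sub_div, add_sub_cancel_left, one_div, ENNReal.ofReal_inv_of_pos hN,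
    ENNReal.ofReal_natCast]

theorem dist_coe_le (t u : ℝ) : dist (t : UnitAddCircle) (u : UnitAddCircle) ≤ |t - u| := by
  rw [dist_eq_norm, ← QuotientAddGroup.mk_sub]
  exact QuotientAddGroup.norm_mk_le_norm

theorem dist_le_of_arc {x y : UnitAddCircle} {d : ℕ} (h : (arc N x : ℕ) ≤ arc N y + d)
    (h' : (arc N y : ℕ) ≤ arc N x + d) : dist x y ≤ (d + 1) / N := by
  have hN : (0 : ℝ) < N := by exact_mod_cast NeZero.pos N
  obtain ⟨t, ht, h1, h2⟩ := exists_coe_of_arc_eq (rfl : arc N x = _)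
  obtain ⟨u, hu, h3, h4⟩ := exists_coe_of_arc_eq (rfl : arc N y = _)
  have h5 : ((arc N x : ℕ) : ℝ) ≤ (arc N y : ℕ) + d := by exact_mod_cast h
  have h6 : ((arc N y : ℕ) : ℝ) ≤ (arc N x : ℕ) + d := by exact_mod_cast h'
  rw [ht, hu]
  refine (dist_coe_le t u).trans ?_
  rw [le_div_iff₀ hN, ← abs_of_pos hN, ← abs_mul, abs_le]
  constructor <;> linarith

variable (N)

/-- The cell of the `N × N` grid of squares of side `1 / N` that contains the point `p`. -/
def cell (p : Torus) : Fin N × Fin N := (arc N p.1, arc N p.2)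

theorem measurable_cell : Measurable (cell N) :=
  ((measurable_arc N).comp measurable_fst).prodMk ((measurable_arc N).comp measurable_snd)

variable {N}

theorem volume_cell_preimage (b : Fin N × Fin N) :
    volume (cell N ⁻¹' {b}) = ((N : ENNReal) ^ 2)⁻¹ := by
  have h : cell N ⁻¹' {b} = (arc N ⁻¹' {b.1}) ×ˢ (arc N ⁻¹' {b.2}) := by
    ext p
    simp [cell, Prod.ext_iff]
  rw [h, Measure.volume_eq_prod, Measure.prod_prod, volume_arc_preimage, volume_arc_preimage,
    sq, ENNReal.mul_inv (by simp) (by simp)]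

/-- Points in two cells that are equal or share a side are at most `√5 / N` apart. -/
theorem torusDist_le_of_adjacent {R : ℝ} (hR : √5 ≤ N * R) {p q : Torus}
    (h : ((cell N p).1 = (cell N q).1 ∧ ((cell N p).2 : ℕ) ≤ (cell N q).2 + 1 ∧
        ((cell N q).2 : ℕ) ≤ (cell N p).2 + 1) ∨
      ((cell N p).2 = (cell N q).2 ∧ ((cell N p).1 : ℕ) ≤ (cell N q).1 + 1 ∧
        ((cell N q).1 : ℕ) ≤ (cell N p).1 + 1)) :
    torusDist p q ≤ R := by
  have hN : (0 : ℝ) < N := by exact_mod_cast NeZero.pos N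
  have key : ∀ a b : ℝ, 0 ≤ a → 0 ≤ b → a ≤ 1 / N → b ≤ 2 / N → a ^ 2 + b ^ 2 ≤ (√5 / N) ^ 2 := by
    intro a b ha hb h1 h2
    have h3 := pow_le_pow_left₀ ha h1 2
    have h4 := pow_le_pow_left₀ hb h2 2
    rw [div_pow, Real.sq_sqrt (by norm_num)]
    calc a ^ 2 + b ^ 2 ≤ (1 / N) ^ 2 + (2 / N) ^ 2 := add_le_add h3 h4
      _ = 5 / N ^ 2 := by ring
  have hs : √5 / N ≤ R := by rwa [div_le_iff₀ hN, mul_comm]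
  refine le_trans ?_ hs
  refine Real.sqrt_le_iff.2 ⟨by positivity, ?_⟩
  rcases h with ⟨h0, h1, h2⟩ | ⟨h0, h1, h2⟩
  · refine key _ _ dist_nonneg dist_nonneg ?_ ?_
    · simpa using dist_le_of_arc (N := N) (x := p.1) (y := q.1) (d := 0) (Fin.ext_iff.1 h0).le
        (Fin.ext_iff.1 h0).ge
    · convert dist_le_of_arc (N := N) (x := p.2) (y := q.2) (d := 1) h1 h2 using 2
      norm_num
  · rw [add_comm]
    refine key _ _ dist_nonneg dist_nonneg ?_ ?_
    · simpa using dist_le_of_arc (N := N) (x := p.2) (y := q.2) (d := 0) (Fin.ext_iff.1 h0).le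
        (Fin.ext_iff.1 h0).ge
    · convert dist_le_of_arc (N := N) (x := p.1) (y := q.1) (d := 1) h1 h2 using 2
      norm_num

end Grid

/-! ### Spreading through the grid -/

/-- A property of `Fin N` that passes to neighbours in both directions and holds somewhere holds
everywhere. -/
theorem forall_fin_of_adjacent {N : ℕ} {P : Fin N → Prop}
    (h : ∀ a b : Fin N, (a : ℕ) ≤ b + 1 → (b : ℕ) ≤ a + 1 → P a → P b) {a : Fin N} (ha : P a)
    (b : Fin N) : P b := by
  have key : ∀ (d : ℕ) (b : Fin N), (a : ℕ) ≤ b + d → (b : ℕ) ≤ a + d → P b := by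
    intro d
    induction d with
    | zero =>
      intro b h1 h2
      rwa [show b = a from Fin.ext (by omega)]
    | succ d ih =>
      intro b h1 h2
      have ha2 := a.2
      have hb2 := b.2
      rcases lt_trichotomy (a : ℕ) b with hlt | heq | hgt
      · exact h ⟨b - 1, by omega⟩ b (by simp only; omega) (by simp only; omega)
          (ih ⟨b - 1, by omega⟩ (by simp only; omega) (by simp only; omega))
      · rwa [show b = a from Fin.ext heq.symm]
      · exact h ⟨b + 1, by omega⟩ b (by simp only; omega) (by simp only; omega)
          (ih ⟨b + 1, by omega⟩ (by simp only; omega) (by simp only; omega))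
  exact key N b (by have := a.2; omega) (by have := b.2; omega)

/-- If every cell holds three nodes and some cell holds three anchors, then everything is
localized: the cell with three anchors fills up, and a full cell fills the cells next to it. -/
theorem allLocalized_of_cells {k N : ℕ} [NeZero N] {R : ℝ} (hR : √5 ≤ N * R)
    {x : Fin k → Torus} {A : Finset (Fin k)}
    (hV : ∀ b, 3 ≤ (Finset.univ.filter fun i => cell N (x i) = b).card)
    (hA : ∃ b, 3 ≤ (A.filter fun i => cell N (x i) = b).card) :
    AllLocalized R ⟨k, x, A⟩ := by
  obtain ⟨t, hAt, hcl⟩ := exists_localizedAt_closed R x A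
  refine ⟨t, ?_⟩
  change localizedAt R x A t = Finset.univ
  set L := localizedAt R x A t
  let P : Fin N × Fin N → Prop := fun b => ∀ i, cell N (x i) = b → i ∈ L
  have hP₀ : ∃ b, P b := by
    obtain ⟨b, hb⟩ := hA
    refine ⟨b, fun i hi => hcl i _ ((Finset.filter_subset _ _).trans hAt) hb fun j hj => ?_⟩
    have hj' := (Finset.mem_filter.1 hj).2
    exact torusDist_le_of_adjacent hR (Or.inl (by rw [hi, hj']; simp))
  have spread : ∀ b b' : Fin N × Fin N,
      ((b'.1 = b.1 ∧ (b'.2 : ℕ) ≤ b.2 + 1 ∧ (b.2 : ℕ) ≤ b'.2 + 1) ∨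
        (b'.2 = b.2 ∧ (b'.1 : ℕ) ≤ b.1 + 1 ∧ (b.1 : ℕ) ≤ b'.1 + 1)) → P b → P b' := by
    intro b b' hbb hb i hi
    refine hcl i _ (fun j hj => hb j (Finset.mem_filter.1 hj).2) (hV b) fun j hj => ?_
    have hj' := (Finset.mem_filter.1 hj).2
    exact torusDist_le_of_adjacent hR (by rwa [hi, hj'])
  obtain ⟨b, hb⟩ := hP₀
  have h1 : ∀ y, P (b.1, y) := forall_fin_of_adjacent (P := fun y => P (b.1, y))
    (fun y y' h h' => spread _ _ (Or.inl ⟨rfl, h', h⟩)) (a := b.2) hb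
  have h2 : ∀ y z, P (z, y) := fun y => forall_fin_of_adjacent (P := fun z => P (z, y))
    (fun z z' h h' => spread _ _ (Or.inr ⟨rfl, h', h⟩)) (a := b.1) (h1 y)
  exact Finset.eq_univ_of_forall fun i => h2 _ _ i rfl

/-! ### Three balls in one bin -/

section Triples

variable {B : Type*} [Fintype B] {l : ℕ}

theorem sum_prod_apply (h : Fin l → B → ℝ) :
    ∑ g : Fin l → B, ∏ i, h i (g i) = ∏ i, ∑ y, h i y := by
  rw [Finset.prod_univ_sum, Fintype.piFinset_univ]

variable [DecidableEq B]

/-- The number of the `l` balls, thrown into the bins `B` according to `g`, that land in `b`. -/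
def load (g : Fin l → B) (b : B) : ℝ := ∑ j, if g j = b then 1 else 0

/-- The number of monochromatic triples with one ball from each of three groups of `l` balls. -/
def tripleCount (f : Fin 3 → Fin l → B) : ℝ := ∑ b, ∏ i, load (f i) b

theorem sum_indicator_apply_eq (hB : 0 < Fintype.card B) (j : Fin l) (b : B) :
    (∑ g : Fin l → B, if g j = b then (1 : ℝ) else 0) =
      (Fintype.card B : ℝ) ^ l / Fintype.card B := by
  have h := sum_prod_apply fun (i : Fin l) (y : B) =>
    if i = j then (if y = b then (1 : ℝ) else 0) else 1
  have hB' : (Fintype.card B : ℝ) ≠ 0 := by exact_mod_cast hB.ne'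
  simp only [Finset.prod_ite_eq', Finset.mem_univ, if_true] at h
  rw [h, ← Finset.mul_prod_erase _ _ (Finset.mem_univ j), Finset.prod_congr rfl
    (g := fun _ => (Fintype.card B : ℝ))]
  · obtain ⟨l, rfl⟩ : ∃ l', l = l' + 1 := ⟨l - 1, by have := j.2; omega⟩
    simp [pow_succ, hB']
  · intro i hi
    simp [Finset.ne_of_mem_erase hi]

theorem sum_indicator_apply_eq_and (hB : 0 < Fintype.card B) {j j' : Fin l} (hj : j ≠ j')
    (b b' : B) :
    (∑ g : Fin l → B, (if g j = b then (1 : ℝ) else 0) * if g j' = b' then 1 else 0) =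
      (Fintype.card B : ℝ) ^ l / Fintype.card B ^ 2 := by
  have h := sum_prod_apply fun (i : Fin l) (y : B) =>
    (if i = j then (if y = b then (1 : ℝ) else 0) else 1) *
      if i = j' then (if y = b' then (1 : ℝ) else 0) else 1
  have hB' : (Fintype.card B : ℝ) ≠ 0 := by exact_mod_cast hB.ne'
  simp only [Finset.prod_mul_distrib, Finset.prod_ite_eq', Finset.mem_univ, if_true] at h
  have hj' : j' ∈ Finset.univ.erase j := Finset.mem_erase.2 ⟨hj.symm, Finset.mem_univ _⟩
  have hl : 2 ≤ l := by
    have h1 := j.2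
    have h2 := j'.2
    have h3 : (j : ℕ) ≠ j' := fun h => hj (Fin.ext h)
    omega
  obtain ⟨l, rfl⟩ := Nat.exists_eq_add_of_le' hl
  rw [h, ← Finset.mul_prod_erase _ _ (Finset.mem_univ j), ← Finset.mul_prod_erase _ _ hj',
    Finset.prod_congr rfl (g := fun _ => (Fintype.card B : ℝ))]
  · rw [Finset.prod_const, Finset.card_erase_of_mem hj',
      Finset.card_erase_of_mem (Finset.mem_univ j)]
    simp [hj, hj.symm, pow_add, hB']
  · intro i hi
    simp [Finset.ne_of_mem_erase hi, Finset.ne_of_mem_erase (Finset.mem_of_mem_erase hi)]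

theorem sum_load (hB : 0 < Fintype.card B) (b : B) :
    ∑ g : Fin l → B, load g b = l * ((Fintype.card B : ℝ) ^ l / Fintype.card B) := by
  simp only [load]
  rw [Finset.sum_comm, Finset.sum_congr rfl fun j _ => sum_indicator_apply_eq hB j b]
  simp

theorem sum_load_mul_load_le (hB : 0 < Fintype.card B) (b b' : B) :
    ∑ g : Fin l → B, load g b * load g b' ≤
      (l : ℝ) ^ 2 * ((Fintype.card B : ℝ) ^ l / Fintype.card B ^ 2) +
        if b = b' then l * ((Fintype.card B : ℝ) ^ l / Fintype.card B) else 0 := by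
  have key : ∀ j j' : Fin l,
      (∑ g : Fin l → B, (if g j = b then (1 : ℝ) else 0) * if g j' = b' then 1 else 0) ≤
        (Fintype.card B : ℝ) ^ l / Fintype.card B ^ 2 +
          if j = j' then (if b = b' then (Fintype.card B : ℝ) ^ l / Fintype.card B else 0)
            else 0 := by
    intro j j'
    by_cases hj : j = j'
    · subst hj
      by_cases hb : b = b'
      · subst hb
        have := sum_indicator_apply_eq hB j b
        simp only [mul_ite, mul_one, mul_zero, if_true]
        have h0 : (0 : ℝ) ≤ (Fintype.card B : ℝ) ^ l / Fintype.card B ^ 2 := by positivity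
        refine le_trans (le_of_eq ?_) (le_add_of_nonneg_left h0)
        rw [← this]
        refine Finset.sum_congr rfl fun g _ => ?_
        split_ifs <;> rfl
      · rw [Finset.sum_eq_zero]
        · simp only [hb, if_true, if_false, add_zero]
          positivity
        · intro g _
          by_cases h : g j = b
          · simp [h, hb]
          · simp [h]
    · rw [sum_indicator_apply_eq_and hB hj]
      simp [hj]
  calc ∑ g : Fin l → B, load g b * load g b'
      = ∑ j, ∑ j', ∑ g : Fin l → B,
          (if g j = b then (1 : ℝ) else 0) * if g j' = b' then 1 else 0 := by
        simp only [load, Finset.sum_mul_sum]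
        rw [Finset.sum_comm]
        exact Finset.sum_congr rfl fun j _ => Finset.sum_comm
    _ ≤ ∑ j : Fin l, ∑ j' : Fin l, ((Fintype.card B : ℝ) ^ l / Fintype.card B ^ 2 +
          if j = j' then (if b = b' then (Fintype.card B : ℝ) ^ l / Fintype.card B else 0)
            else 0) := Finset.sum_le_sum fun j _ => Finset.sum_le_sum fun j' _ => key j j'
    _ = _ := by
        simp only [Finset.sum_add_distrib, Finset.sum_ite_eq, Finset.mem_univ, if_true,
          Finset.sum_const, Finset.card_univ, Fintype.card_fin, nsmul_eq_mul]
        split_ifs <;> ring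

theorem sum_tripleCount (hB : 0 < Fintype.card B) :
    ∑ f : Fin 3 → Fin l → B, tripleCount f =
      Fintype.card B * (l * ((Fintype.card B : ℝ) ^ l / Fintype.card B)) ^ 3 := by
  simp only [tripleCount]
  rw [Finset.sum_comm]
  rw [Finset.sum_congr rfl fun b _ => (Fintype.sum_pow (fun g : Fin l → B => load g b) 3).symm]
  simp [sum_load hB]

theorem sum_tripleCount_sq_le (hB : 0 < Fintype.card B) :
    ∑ f : Fin 3 → Fin l → B, tripleCount f ^ 2 ≤
      Fintype.card B ^ 2 * ((l : ℝ) ^ 2 * ((Fintype.card B : ℝ) ^ l / Fintype.card B ^ 2)) ^ 3 +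
      Fintype.card B * ((l : ℝ) ^ 2 * ((Fintype.card B : ℝ) ^ l / Fintype.card B ^ 2) +
        l * ((Fintype.card B : ℝ) ^ l / Fintype.card B)) ^ 3 := by
  set M : ℝ := (Fintype.card B : ℝ)
  set p : ℝ := (l : ℝ) ^ 2 * (M ^ l / M ^ 2)
  set q : ℝ := l * (M ^ l / M)
  have hp : 0 ≤ p := by positivity
  have hq : 0 ≤ q := by positivity
  have hnn : ∀ (g : Fin l → B) b, 0 ≤ load g b := fun g b =>
    Finset.sum_nonneg fun j _ => by split_ifs <;> norm_num
  calc ∑ f : Fin 3 → Fin l → B, tripleCount f ^ 2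
      = ∑ b, ∑ b', (∑ g : Fin l → B, load g b * load g b') ^ 3 := by
        simp only [tripleCount, sq, Finset.sum_mul_sum, ← Finset.prod_mul_distrib]
        rw [Finset.sum_comm]
        refine Finset.sum_congr rfl fun b _ => ?_
        rw [Finset.sum_comm]
        exact Finset.sum_congr rfl fun b' _ =>
          (Fintype.sum_pow (fun g : Fin l → B => load g b * load g b') 3).symm
    _ ≤ ∑ b : B, ∑ b' : B, (p ^ 3 + if b = b' then (p + q) ^ 3 else 0) := by
        refine Finset.sum_le_sum fun b _ => Finset.sum_le_sum fun b' _ => ?_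
        refine (pow_le_pow_left₀ (Finset.sum_nonneg fun g _ => mul_nonneg (hnn g b) (hnn g b'))
          (sum_load_mul_load_le hB b b') 3).trans ?_
        split_ifs
        · exact le_add_of_nonneg_left (by positivity)
        · simp [p, M]
    _ = M ^ 2 * p ^ 3 + M * (p + q) ^ 3 := by
        simp only [Finset.sum_add_distrib, Finset.sum_ite_eq, Finset.mem_univ, if_true,
          Finset.sum_const, Finset.card_univ, nsmul_eq_mul]
        ring

/-- Chebyshev's inequality for `tripleCount`: the proportion of the throws of three groups of `l`
balls that have no monochromatic triple. -/
theorem card_tripleCount_eq_zero_le (hB : 0 < Fintype.card B) (hl : 0 < l) :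
    ((Finset.univ.filter fun f : Fin 3 → Fin l → B => tripleCount f = 0).card : ℝ) ≤
      (Fintype.card B : ℝ) ^ (3 * l) * ((1 + Fintype.card B / l) ^ 3 / Fintype.card B) := by
  have h1 := sum_tripleCount (l := l) hB
  have h2 := sum_tripleCount_sq_le (l := l) hB
  have hcard : (Fintype.card (Fin 3 → Fin l → B) : ℝ) = (Fintype.card B : ℝ) ^ (3 * l) := by
    simp [Fintype.card_pi, pow_mul']
  set M : ℝ := (Fintype.card B : ℝ)
  have hM : 0 < M := Nat.cast_pos.2 hB
  have hl' : (0 : ℝ) < l := by exact_mod_cast hl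
  -- the mean of `tripleCount`
  set μ : ℝ := l ^ 3 / M ^ 2
  have hμ : 0 < μ := by positivity
  have h3 : ((Finset.univ.filter fun f : Fin 3 → Fin l → B => tripleCount f = 0).card : ℝ) * μ ^ 2
      ≤ ∑ f : Fin 3 → Fin l → B, (tripleCount f - μ) ^ 2 := by
    rw [← nsmul_eq_mul, ← Finset.sum_const]
    refine (Finset.sum_le_sum fun f hf => ?_).trans
      (Finset.sum_le_sum_of_subset_of_nonneg (Finset.filter_subset _ _) fun f _ _ => sq_nonneg _)
    rw [(Finset.mem_filter.1 hf).2]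
    simp
  have h4 : ∑ f : Fin 3 → Fin l → B, (tripleCount f - μ) ^ 2 =
      ∑ f : Fin 3 → Fin l → B, tripleCount f ^ 2 -
        2 * μ * ∑ f : Fin 3 → Fin l → B, tripleCount f + M ^ (3 * l) * μ ^ 2 := by
    simp only [sub_sq, Finset.sum_add_distrib, Finset.sum_sub_distrib, Finset.mul_sum,
      Finset.sum_const, Finset.card_univ, nsmul_eq_mul, hcard]
    congr 2
    exact Finset.sum_congr rfl fun f _ => by ring
  have h5 : M * ((l : ℝ) ^ 2 * (M ^ l / M ^ 2) + l * (M ^ l / M)) ^ 3 =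
      M ^ (3 * l) * ((1 + M / l) ^ 3 / M) * μ ^ 2 := by
    simp only [μ]
    rw [pow_mul']
    field_simp
  have h6 : M ^ 2 * ((l : ℝ) ^ 2 * (M ^ l / M ^ 2)) ^ 3 = M ^ (3 * l) * μ ^ 2 := by
    simp only [μ]
    rw [pow_mul']
    field_simp
  have h7 : 2 * μ * (M * (l * (M ^ l / M)) ^ 3) = 2 * (M ^ (3 * l) * μ ^ 2) := by
    simp only [μ]
    rw [pow_mul']
    field_simp
  -- by `h6` and `h7` the square of the mean cancels, and `h5` is what the diagonal contributes
  refine le_of_mul_le_mul_right (h3.trans ?_) (pow_pos hμ 2)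
  rw [h4, h1, h7, ← h5]
  linarith

theorem tripleCount_eq_zero {f : Fin 3 → Fin l → B}
    (h : ∀ b, (Finset.univ.filter fun p : Fin 3 × Fin l => f p.1 p.2 = b).card < 3) :
    tripleCount f = 0 := by
  refine Finset.sum_eq_zero fun b _ => ?_
  by_contra hne
  have hex : ∀ i, ∃ j, f i j = b := by
    intro i
    by_contra! hi
    exact hne (Finset.prod_eq_zero (Finset.mem_univ i)
      (Finset.sum_eq_zero fun j _ => by simp [hi j]))
  choose j hj using hex
  refine (h b).not_ge ?_
  have hinj : Function.Injective fun i => (i, j i) := fun i i' h => (Prod.ext_iff.1 h).1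
  have := Finset.card_le_card_of_injOn (s := (Finset.univ : Finset (Fin 3)))
    (t := Finset.univ.filter fun p : Fin 3 × Fin l => f p.1 p.2 = b) (fun i => (i, j i))
    (fun i _ => by simpa using hj i) hinj.injOn
  simpa using this

end Triples

/-- Independent uniform points rarely leave every cell with fewer than three of the points indexed
by `A`. -/
theorem volume_no_triple_le {k N : ℕ} [NeZero N] {A : Finset (Fin k)} {l : ℕ} (hl : 0 < l)
    (hA : 3 * l ≤ A.card) :
    (volume : Measure (Fin k → Torus))
        {x | ∀ b, (A.filter fun i => cell N (x i) = b).card < 3} ≤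
      ENNReal.ofReal ((1 + (N : ℝ) ^ 2 / l) ^ 3 / (N : ℝ) ^ 2) := by
  classical
  have hN : 0 < N := NeZero.pos N
  obtain ⟨e⟩ : Nonempty (Fin 3 × Fin l ↪ A) :=
    Function.Embedding.nonempty_of_card_le (by simpa using hA)
  have hinj : Function.Injective fun p => (e p : Fin k) :=
    Subtype.val_injective.comp e.injective
  set T := Finset.univ.filter fun f : Fin 3 → Fin l → Fin N × Fin N => tripleCount f = 0
  -- the cells of the chosen points are independent and uniform
  have hbox : ∀ f : Fin 3 → Fin l → Fin N × Fin N, (volume : Measure (Fin k → Torus))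
      (⋂ p : Fin 3 × Fin l, {x | cell N (x (e p)) = f p.1 p.2}) =
        ((N : ENNReal) ^ 2)⁻¹ ^ (3 * l) := by
    intro f
    have hind : iIndepFun (fun (p : Fin 3 × Fin l) (x : Fin k → Torus) => x (e p)) volume :=
      (iIndepFun_pi (μ := fun _ : Fin k => (volume : Measure Torus)) (X := fun _ y => y)
        fun _ => aemeasurable_id).precomp hinj
    rw [hind.meas_iInter fun p => ?_]
    · rw [Finset.prod_congr rfl (g := fun _ => ((N : ENNReal) ^ 2)⁻¹)]
      · simp
      · intro p _
        rw [← volume_cell_preimage (f p.1 p.2)]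
        exact (measurePreserving_eval (fun _ : Fin k => (volume : Measure Torus))
          (e p)).measure_preimage
          (measurable_cell N (measurableSet_singleton _)).nullMeasurableSet
    · exact ⟨_, measurable_cell N (measurableSet_singleton (f p.1 p.2)), rfl⟩
  have hsub : {x : Fin k → Torus | ∀ b, (A.filter fun i => cell N (x i) = b).card < 3} ⊆
      ⋃ f ∈ T, ⋂ p : Fin 3 × Fin l, {x | cell N (x (e p)) = f p.1 p.2} := by
    intro x hx
    refine Set.mem_biUnion (x := fun i j => cell N (x (e (i, j)))) ?_ (by simp)
    refine Finset.mem_coe.2 (Finset.mem_filter.2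
      ⟨Finset.mem_univ _, tripleCount_eq_zero fun b => ?_⟩)
    refine lt_of_le_of_lt ?_ (hx b)
    refine Finset.card_le_card_of_injOn (fun p => (e p : Fin k)) (fun p hp => ?_) hinj.injOn
    simpa using hp
  have hc : Fintype.card (Fin N × Fin N) = N ^ 2 := by simp [sq]
  have hT := card_tripleCount_eq_zero_le (B := Fin N × Fin N) (l := l) (by rw [hc]; positivity) hl
  rw [hc] at hT
  push_cast at hT
  have hN' : (0 : ℝ) < N := by exact_mod_cast hN
  refine ((measure_mono hsub).trans (measure_biUnion_finset_le _ _)).trans ?_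
  simp_rw [hbox]
  rw [Finset.sum_const, nsmul_eq_mul]
  have h1 : ((N : ENNReal) ^ 2)⁻¹ ^ (3 * l) = ENNReal.ofReal ((((N : ℝ) ^ 2) ^ (3 * l))⁻¹) := by
    rw [ENNReal.ofReal_inv_of_pos (by positivity), ENNReal.ofReal_pow (by positivity),
      ENNReal.ofReal_pow (by positivity), ENNReal.ofReal_natCast]
    exact ENNReal.inv_pow.symm
  rw [h1, ← ENNReal.ofReal_natCast, ← ENNReal.ofReal_mul (by positivity)]
  refine ENNReal.ofReal_le_ofReal ?_
  rw [← div_eq_mul_inv, div_le_iff₀ (by positivity), mul_comm]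
  exact hT

/-! ### Sparsely populated cells -/

/-- Chernoff's bound for the number of `k` independent points that lie in a given cell, with the
exponential weight `2 / 7`. -/
theorem volume_cell_sparse_le {k N : ℕ} [NeZero N] (b : Fin N × Fin N) :
    (volume : Measure (Fin k → Torus))
        {x | (Finset.univ.filter fun i => cell N (x i) = b).card < 3} ≤
      ENNReal.ofReal (49 / 4 * (1 - 5 / 7 / (N : ℝ) ^ 2) ^ k) := by
  classical
  have hN : (1 : ℝ) ≤ N := by exact_mod_cast NeZero.pos N
  set C := cell N ⁻¹' {b} with hCdef
  have hC : MeasurableSet C := measurable_cell N (measurableSet_singleton b)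
  have hCv : volume.real C = ((N : ℝ) ^ 2)⁻¹ := by
    rw [Measure.real, volume_cell_preimage]
    simp
  let h : Torus → ℝ := fun p => 1 - C.indicator (fun _ => 5 / 7) p
  have hint : ∫ p, h p = 1 - 5 / 7 / (N : ℝ) ^ 2 := by
    rw [integral_sub (integrable_const _) ((integrable_const _).indicator hC),
      integral_indicator_const _ hC, hCv]
    simp
    ring
  have hh : ∀ p, h p = if cell N p = b then 2 / 7 else 1 := by
    intro p
    by_cases hp : cell N p = b
    · have : p ∈ C := hp
      simp only [h, hp, Set.indicator_of_mem this]
      norm_num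
    · have : p ∉ C := hp
      simp [h, hp, Set.indicator_of_notMem this]
  have hprod : ∀ x : Fin k → Torus, ∏ i, h (x i) =
      (2 / 7 : ℝ) ^ (Finset.univ.filter fun i => cell N (x i) = b).card := by
    intro x
    simp only [hh]
    rw [Finset.prod_ite, Finset.prod_const, Finset.prod_const_one, mul_one]
  have hpos : ∀ x : Fin k → Torus, 0 ≤ ∏ i, h (x i) := fun x => by rw [hprod]; positivity
  have hmeas : Measurable h := measurable_const.sub (measurable_const.indicator hC)
  have hI : Integrable (fun x : Fin k → Torus => ∏ i, h (x i)) := by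
    refine Integrable.of_bound (C := 1) ?_ (.of_forall fun x => ?_)
    · exact (Finset.measurable_prod _ fun i _ =>
        hmeas.comp (measurable_pi_apply i)).aestronglyMeasurable
    · rw [Real.norm_of_nonneg (hpos x), hprod]
      exact pow_le_one₀ (by norm_num) (by norm_num)
  have hmarkov := mul_meas_ge_le_integral_of_nonneg (.of_forall hpos) hI (4 / 49)
  rw [integral_fintype_prod_volume_eq_pow, hint, Fintype.card_fin] at hmarkov
  have hsub : {x : Fin k → Torus | (Finset.univ.filter fun i => cell N (x i) = b).card < 3} ⊆
      {x | 4 / 49 ≤ ∏ i, h (x i)} := by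
    intro x hx
    change 4 / 49 ≤ ∏ i, h (x i)
    rw [hprod]
    calc (4 / 49 : ℝ) = (2 / 7) ^ 2 := by norm_num
      _ ≤ _ := pow_le_pow_of_le_one (by norm_num) (by norm_num) (Nat.le_of_lt_succ hx)
  refine (measure_mono hsub).trans ?_
  rw [← ofReal_measureReal]
  exact ENNReal.ofReal_le_ofReal (by linarith)

theorem hasSum_poisson_pow (n : ℕ) (q : ℝ) :
    HasSum (fun k : ℕ => Real.exp (-n) * n ^ k / k.factorial * q ^ k)
      (Real.exp (-(n * (1 - q)))) := by
  have h := (NormedSpace.expSeries_div_hasSum_exp ((n : ℝ) * q)).mul_left (Real.exp (-n))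
  rw [← Real.exp_eq_exp_ℝ, ← Real.exp_add] at h
  rw [show -((n : ℝ) * (1 - q)) = -n + n * q by ring]
  refine h.congr_fun fun k => ?_
  rw [mul_pow]
  ring

/-- Averaging the bound of `volume_cell_sparse_le` over a Poisson number of points. -/
theorem tsum_poisson_mul_pow (n : ℕ) {a q : ℝ} (ha : 0 ≤ a) (hq : 0 ≤ q) :
    ∑' k : ℕ, poissonMeasure (n : NNReal) {k} * ENNReal.ofReal (a * q ^ k) =
      ENNReal.ofReal (a * Real.exp (-(n * (1 - q)))) := by
  have h := (hasSum_poisson_pow n q).mul_left a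
  rw [← h.tsum_eq, ENNReal.ofReal_tsum_of_nonneg (fun k => by positivity) h.summable]
  refine tsum_congr fun k => ?_
  rw [poissonMeasure_singleton, ← ENNReal.ofReal_mul (by positivity)]
  congr 1
  simp only [NNReal.coe_natCast]
  ring

/-! ### The failure probability -/

instance (k m : ℕ) : IsProbabilityMeasure (anchorLaw k m).toMeasure :=
  PMF.toMeasure.isProbabilityMeasure _

theorem ae_anchorLaw_card (k m : ℕ) : ∀ᵐ A ∂(anchorLaw k m).toMeasure, A.card = min m k := by
  rw [ae_iff, PMF.toMeasure_apply_eq_zero_iff _ (MeasurableSet.of_discrete)]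
  rw [Set.disjoint_left]
  intro A hA
  rw [anchorLaw, PMF.mem_support_uniformOfFinset_iff, Finset.mem_powersetCard] at hA
  simpa using hA.2

/-- For a fixed number of nodes, failure requires a sparse cell or the lack of three anchors in a
common cell. -/
theorem measure_not_allLocalized_le {k m l N : ℕ} [NeZero N] {R : ℝ} (hR : √5 ≤ N * R)
    (hl : 0 < l) (hlm : 3 * l ≤ m) :
    ((volume : Measure (Fin k → Torus)).prod (anchorLaw k m).toMeasure)
        {a | AllLocalized R ⟨k, a⟩}ᶜ ≤
      (N : ENNReal) ^ 2 * ENNReal.ofReal (49 / 4 * (1 - 5 / 7 / (N : ℝ) ^ 2) ^ k) +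
        ENNReal.ofReal ((1 + (N : ℝ) ^ 2 / l) ^ 3 / (N : ℝ) ^ 2) := by
  classical
  rw [Measure.prod_apply_symm (measurableSet_allLocalized R).compl]
  set K := (N : ENNReal) ^ 2 * ENNReal.ofReal (49 / 4 * (1 - 5 / 7 / (N : ℝ) ^ 2) ^ k) +
        ENNReal.ofReal ((1 + (N : ℝ) ^ 2 / l) ^ 3 / (N : ℝ) ^ 2)
  calc _ ≤ ∫⁻ _, K ∂(anchorLaw k m).toMeasure := ?_
    _ = K := by simp
  refine lintegral_mono_ae ?_
  filter_upwards [ae_anchorLaw_card k m] with A hA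
  by_cases hkm : k ≤ m
  · -- all nodes are anchors
    have hAu : A = Finset.univ := by
      rw [← Finset.card_eq_iff_eq_univ, hA, Fintype.card_fin, min_eq_right hkm]
    have : (fun x : Fin k → Torus => (x, A)) ⁻¹' {a | AllLocalized R ⟨k, a⟩}ᶜ = ∅ := by
      refine Set.eq_empty_of_forall_notMem fun x hx => hx ⟨0, ?_⟩
      exact hAu
    rw [this, measure_empty]
    exact zero_le
  · rw [min_eq_left (by omega)] at hA
    have hsub : (fun x : Fin k → Torus => (x, A)) ⁻¹' {a | AllLocalized R ⟨k, a⟩}ᶜ ⊆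
        (⋃ b ∈ (Finset.univ : Finset (Fin N × Fin N)),
          {x | (Finset.univ.filter fun i => cell N (x i) = b).card < 3}) ∪
        {x | ∀ b, (A.filter fun i => cell N (x i) = b).card < 3} := by
      intro x hx
      by_contra hcon
      simp only [Set.mem_union, Set.mem_iUnion, Finset.mem_univ, exists_prop, true_and, not_or,
        not_exists, Set.mem_ofPred_eq, not_forall, not_lt] at hcon
      exact hx (allLocalized_of_cells hR hcon.1 hcon.2)
    refine (measure_mono hsub).trans ((measure_union_le _ _).trans (add_le_add ?_
      (volume_no_triple_le hl (by rwa [hA]))))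
    refine (measure_biUnion_finset_le _ _).trans
      ((Finset.sum_le_sum fun b _ => volume_cell_sparse_le b).trans_eq ?_)
    simp [sq]

theorem measurableEmbedding_sigmaMk {α : Type*} {β : α → Type*} [∀ a, MeasurableSpace (β a)]
    (a : α) : MeasurableEmbedding (Sigma.mk a : β a → Sigma β) where
  injective := sigma_mk_injective
  measurable := fun _ hs => MeasurableSpace.measurableSet_iInf.1 hs a
  measurableSet_image' := by
    intro s hs
    refine MeasurableSpace.measurableSet_iInf.2 fun a' => ?_
    change MeasurableSet (Sigma.mk a' ⁻¹' (Sigma.mk a '' s))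
    by_cases h : a' = a
    · subst h
      rwa [Set.preimage_image_eq _ sigma_mk_injective]
    · rw [Set.preimage_image_sigmaMk_of_ne h]
      exact .empty

theorem networkLaw_apply (n m : ℕ) (s : Set Network) :
    networkLaw n m s = ∑' k : ℕ, poissonMeasure (n : NNReal) {k} *
      ((volume : Measure (Fin k → Torus)).prod (anchorLaw k m).toMeasure)
        ((fun a => (⟨k, a⟩ : Network)) ⁻¹' s) := by
  rw [networkLaw, Measure.sum_apply_of_countable]
  refine tsum_congr fun k => ?_
  have hk : MeasurableEmbedding (fun a => (⟨k, a⟩ : Network)) :=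
    measurableEmbedding_sigmaMk (β := fun k => (Fin k → Torus) × Finset (Fin k)) k
  rw [Measure.smul_apply, hk.map_apply, smul_eq_mul]

theorem tsum_poissonMeasure_singleton (n : ℕ) :
    ∑' k : ℕ, poissonMeasure (n : NNReal) {k} = 1 := by
  have h := tsum_poisson_mul_pow n zero_le_one zero_le_one
  simpa using h

instance (n m : ℕ) : IsProbabilityMeasure (networkLaw n m) :=
  ⟨by simp [networkLaw_apply, tsum_poissonMeasure_singleton]⟩

/-- The failure probability of localization, for a grid of `N × N` cells and anchors of which
three disjoint groups of `l` can be formed. -/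
theorem networkLaw_not_allLocalized_le {n m l N : ℕ} [NeZero N] {R : ℝ} (hR : √5 ≤ N * R)
    (hl : 0 < l) (hlm : 3 * l ≤ m) :
    networkLaw n m {ω | AllLocalized R ω}ᶜ ≤
      ENNReal.ofReal ((N : ℝ) ^ 2 * (49 / 4 * Real.exp (-(5 / 7 * (n / (N : ℝ) ^ 2)))) +
        (1 + (N : ℝ) ^ 2 / l) ^ 3 / (N : ℝ) ^ 2) := by
  have hN : (1 : ℝ) ≤ (N : ℝ) ^ 2 := one_le_pow₀ (by exact_mod_cast NeZero.pos N)
  have hq : 0 ≤ 1 - 5 / 7 / (N : ℝ) ^ 2 := by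
    rw [sub_nonneg, div_le_one (by positivity)]
    linarith
  rw [networkLaw_apply]
  refine (ENNReal.tsum_le_tsum fun k =>
    mul_le_mul_right (measure_not_allLocalized_le hR hl hlm) _).trans ?_
  simp_rw [mul_add, mul_left_comm _ ((N : ENNReal) ^ 2)]
  rw [ENNReal.tsum_add, ENNReal.tsum_mul_left, ENNReal.tsum_mul_right,
    tsum_poisson_mul_pow n (by norm_num) hq, tsum_poissonMeasure_singleton, one_mul,
    ENNReal.ofReal_add (by positivity) (by positivity),
    ENNReal.ofReal_mul (p := (N : ℝ) ^ 2) (by positivity),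
    ENNReal.ofReal_pow (by positivity), ENNReal.ofReal_natCast]
  refine le_of_eq ?_
  congr 6
  ring

/-! ### Asymptotics -/

/-- The covering condition in a usable form: with `ν = n π τ ^ 2`, the expected number of
empty discs among `1 / r ^ 2` discs of radius `τ` tends to zero. -/
theorem tendsto_exp_div_sq {r ν : ℕ → ℝ} (hr : ∀ᶠ n in atTop, 0 < r n) (hν : ∀ n, 0 ≤ ν n)
    (h : Tendsto (fun n => (1 - Real.exp (-ν n)) ^ (2 / r n ^ 2)) atTop (𝓝 1)) :
    Tendsto (fun n => Real.exp (-ν n) / r n ^ 2) atTop (𝓝 0) := by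
  have h1 : Tendsto (fun n => Real.exp (-(Real.exp (-ν n) * (2 / r n ^ 2)))) atTop (𝓝 1) := by
    refine tendsto_of_tendsto_of_tendsto_of_le_of_le' h tendsto_const_nhds ?_ ?_
    · filter_upwards [hr] with n hn
      rw [← neg_mul, Real.exp_mul]
      refine Real.rpow_le_rpow ?_ (Real.one_sub_le_exp_neg _) (by positivity)
      rw [sub_nonneg, Real.exp_le_one_iff]
      exact neg_nonpos.2 (hν n)
    · refine .of_forall fun n => Real.exp_le_one_iff.2 (neg_nonpos.2 ?_)
      positivity
  have h2 := ((Real.continuousAt_log one_ne_zero).tendsto.comp h1).neg.div_const 2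
  simp only [Function.comp_def, Real.log_exp, neg_neg, Real.log_one, neg_zero, zero_div] at h2
  refine h2.congr fun n => ?_
  ring

theorem tendsto_log_pow_div_sq (j : ℕ) :
    Tendsto (fun y : ℝ => Real.log y ^ j / y ^ 2) atTop (𝓝 0) := by
  have h := (Real.isLittleO_pow_log_id_atTop (n := j)).tendsto_div_nhds_zero.mul
    tendsto_inv_atTop_zero
  rw [zero_mul] at h
  refine h.congr fun y => ?_
  simp only [id]
  rw [div_mul_eq_mul_div, ← div_eq_mul_inv, div_div, sq]

theorem tendsto_one_add_log_pow_three_div_sq (K : ℝ) :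
    Tendsto (fun y : ℝ => (1 + K * Real.log y) ^ 3 * (2 / y ^ 2)) atTop (𝓝 0) := by
  have h := ((((tendsto_log_pow_div_sq 0).const_mul 2).add
    ((tendsto_log_pow_div_sq 1).const_mul (6 * K))).add
    ((tendsto_log_pow_div_sq 2).const_mul (6 * K ^ 2))).add
    ((tendsto_log_pow_div_sq 3).const_mul (2 * K ^ 3))
  simp only [mul_zero, add_zero] at h
  refine h.congr fun y => ?_
  ring

/-- The number of anchors forced by the anchor density: at least of order `1 / (r² log (1 / r))`. -/
theorem lt_anchors {c r L a M : ℝ} (hc : 0 < c) (hL : 0 < L)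
    (ha : a ≤ 1 / 2) (hq : 1 - (Real.exp (-(M * π * r ^ 2)) - a) / (1 - a) > c / L) :
    c < 2 * π * L * (M * r ^ 2) := by
  have h1 : 0 < 1 - a := by linarith
  have h2 : 1 - (Real.exp (-(M * π * r ^ 2)) - a) / (1 - a) =
      (1 - Real.exp (-(M * π * r ^ 2))) / (1 - a) := by
    field_simp
    ring
  rw [h2, gt_iff_lt, div_lt_div_iff₀ hL h1] at hq
  have h3 := Real.one_sub_le_exp_neg (M * π * r ^ 2)
  have h4 : (1 - Real.exp (-(M * π * r ^ 2))) * L ≤ (M * π * r ^ 2) * L :=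
    mul_le_mul_of_nonneg_right (by linarith) hL.le
  nlinarith

/-- The failure probability in terms of the quantities whose limits are known. The grid has
`⌈√5 / R⌉` cells to a side, where `R = r + 2 τ`. -/
theorem networkLaw_not_allLocalized_le_of_small {n m : ℕ} {r τ c L : ℝ} (hc : 0 < c)
    (hr : 0 < r) (hτ : 0 < τ) (hτr : τ < r / (2 * √2)) (hr1 : r ≤ 1 / 50) (hL : 0 < L)
    (hm : c < 2 * π * L * (m * r ^ 2)) (hLc : 6 * π * L * r ^ 2 ≤ c) :
    networkLaw n m {ω | AllLocalized (r + 2 * τ) ω}ᶜ ≤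
      ENNReal.ofReal (245 / 2 * (Real.exp (-(n * π * τ ^ 2)) / r ^ 2) +
        (1 + 120 * π / c * L) ^ 3 * r ^ 2) := by
  set R := r + 2 * τ with hRdef
  have hR : 0 < R := by positivity
  have h5 : 0 < √5 := by positivity
  have h2a : 1.414 ≤ √2 := Real.le_sqrt_of_sq_le (by norm_num)
  have h5a : √5 ≤ 2.237 := Real.sqrt_le_iff.2 ⟨by norm_num, by norm_num⟩
  have hτr' : 2.828 * τ ≤ r := by
    rw [lt_div_iff₀ (by positivity)] at hτr
    nlinarith
  have hRr : R ≤ 2 * r := by linarith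
  have hRτ : 4.828 * τ ≤ R := by linarith
  set N := ⌈√5 / R⌉₊ with hNdef
  have hNpos : 0 < N := Nat.ceil_pos.2 (by positivity)
  have : NeZero N := ⟨hNpos.ne'⟩
  have hN : (0 : ℝ) < N := by exact_mod_cast hNpos
  have hNR : √5 ≤ N * R := by
    have := Nat.le_ceil (√5 / R)
    rwa [div_le_iff₀ hR] at this
  have hNR' : N * R ≤ √5 + R := by
    have := (Nat.ceil_lt_add_one (a := √5 / R) (by positivity)).le
    calc N * R ≤ (√5 / R + 1) * R := mul_le_mul_of_nonneg_right this hR.le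
      _ = √5 + R := by field_simp
  have hNR2 : (N : ℝ) ^ 2 * R ^ 2 ≤ 5.2 := by
    rw [← mul_pow]
    calc (N * R) ^ 2 ≤ 2.277 ^ 2 := pow_le_pow_left₀ (by positivity) (by linarith) 2
      _ ≤ 5.2 := by norm_num
  have hNr : (N : ℝ) ^ 2 ≤ 10 / r ^ 2 := by
    rw [le_div_iff₀ (by positivity)]
    have : r ^ 2 ≤ R ^ 2 := pow_le_pow_left₀ hr.le (by linarith) 2
    nlinarith [sq_nonneg (N : ℝ)]
  have hNinv : 1 / (N : ℝ) ^ 2 ≤ r ^ 2 := by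
    rw [div_le_iff₀ (by positivity)]
    have h1 : 5 ≤ (N : ℝ) ^ 2 * R ^ 2 := by
      rw [← mul_pow]
      calc (5 : ℝ) = √5 ^ 2 := (Real.sq_sqrt (by norm_num)).symm
        _ ≤ _ := pow_le_pow_left₀ h5.le hNR 2
    have h2 : R ^ 2 ≤ (2 * r) ^ 2 := pow_le_pow_left₀ hR.le hRr 2
    nlinarith [sq_nonneg (N : ℝ)]
  -- a cell is larger than a disc of radius `τ`, by a factor of at least `7 / 5`
  have hcell : (n : ℝ) * π * τ ^ 2 ≤ 5 / 7 * (n / (N : ℝ) ^ 2) := by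
    rw [← mul_div_assoc, le_div_iff₀ (by positivity)]
    have h1 : (4.828 * τ) ^ 2 ≤ R ^ 2 := pow_le_pow_left₀ (by positivity) hRτ 2
    have h2 : (N : ℝ) ^ 2 * (4.828 * τ) ^ 2 ≤ 5.2 :=
      (mul_le_mul_of_nonneg_left h1 (sq_nonneg _)).trans hNR2
    have h3 : τ ^ 2 * (N : ℝ) ^ 2 ≤ 5.2 / 4.828 ^ 2 := by
      rw [le_div_iff₀ (by norm_num)]
      linarith
    have h4 : π * (τ ^ 2 * (N : ℝ) ^ 2) ≤ 5 / 7 := by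
      calc π * (τ ^ 2 * (N : ℝ) ^ 2) ≤ 3.15 * (5.2 / 4.828 ^ 2) :=
            mul_le_mul Real.pi_lt_d2.le h3 (by positivity) (by norm_num)
        _ ≤ 5 / 7 := by norm_num
    have := mul_le_mul_of_nonneg_left h4 (Nat.cast_nonneg (α := ℝ) n)
    linarith
  have hm3 : 3 < m := by
    have h1 : 2 * π * L * r ^ 2 * 3 < 2 * π * L * r ^ 2 * m := by linarith
    exact_mod_cast lt_of_mul_lt_mul_left h1 (by positivity)
  set l := m / 3
  have hl : 0 < l := by omega
  have hlm : 3 * l ≤ m := by omega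
  have hml : (m : ℝ) ≤ 6 * l := by
    exact_mod_cast (by omega : m ≤ 6 * l)
  have hNl : (N : ℝ) ^ 2 / l ≤ 120 * π / c * L := by
    have hl' : (0 : ℝ) < l := by exact_mod_cast hl
    rw [div_mul_eq_mul_div, div_le_div_iff₀ hl' hc]
    rw [le_div_iff₀ (by positivity)] at hNr
    have h1 : c ≤ 2 * π * L * (6 * l * r ^ 2) := hm.le.trans (by gcongr)
    calc (N : ℝ) ^ 2 * c ≤ (N : ℝ) ^ 2 * (2 * π * L * (6 * l * r ^ 2)) := by gcongr
      _ = ((N : ℝ) ^ 2 * r ^ 2) * (12 * π * L * l) := by ring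
      _ ≤ 10 * (12 * π * L * l) := by gcongr
      _ = 120 * π * L * l := by ring
  refine (networkLaw_not_allLocalized_le hNR hl hlm).trans (ENNReal.ofReal_le_ofReal ?_)
  refine add_le_add ?_ ?_
  · calc (N : ℝ) ^ 2 * (49 / 4 * Real.exp (-(5 / 7 * (n / (N : ℝ) ^ 2))))
        ≤ 10 / r ^ 2 * (49 / 4 * Real.exp (-(n * π * τ ^ 2))) := by gcongr
      _ = 245 / 2 * (Real.exp (-(n * π * τ ^ 2)) / r ^ 2) := by ring
  · rw [div_eq_mul_one_div]
    gcongr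

end IterLoc

end

theorem corollary1 (c : ℝ) (hc : 0 < c) (r τ : ℕ → ℝ) (m : ℕ → ℕ)
    (hr : ∀ᶠ n in atTop, 0 < r n)
    (hr0 : Tendsto r atTop (𝓝 0))
    (hτ : ∀ᶠ n in atTop, 0 < τ n ∧ τ n < r n / (2 * √2))
    (hτr : τ =Θ[atTop] r)
    (hcover : Tendsto (fun n : ℕ => (1 - Real.exp (-((n : ℝ) * π * τ n ^ 2))) ^ (2 / r n ^ 2))
      atTop (𝓝 1))
    (hq : ∀ᶠ n : ℕ in atTop,
      1 - (Real.exp (-((m n : ℝ) * π * r n ^ 2)) - Real.exp (-((n : ℝ) * π * r n ^ 2))) /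
          (1 - Real.exp (-((n : ℝ) * π * r n ^ 2)))
        > c / Real.log (√2 / r n)) :
    (fun n => r n + 2 * τ n) =Θ[atTop] r ∧
    Tendsto
      (fun n : ℕ => IterLoc.networkLaw n (m n) {ω | IterLoc.AllLocalized (r n + 2 * τ n) ω})
      atTop (𝓝 1) := by
  constructor
  · constructor
    · exact (isBigO_refl r atTop).add (hτr.isBigO.const_mul_left 2)
    · refine IsBigO.of_bound 1 ?_
      filter_upwards [hr, hτ] with n h1 h2
      rw [one_mul, Real.norm_of_nonneg h1.le, Real.norm_of_nonneg (by linarith)]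
      linarith
  have hexp := IterLoc.tendsto_exp_div_sq hr (fun n => by positivity) hcover
  have hy : Tendsto (fun n => √2 / r n) atTop atTop := by
    have hr' : Tendsto r atTop (𝓝[>] 0) := tendsto_nhdsWithin_iff.2 ⟨hr0, hr⟩
    exact (tendsto_inv_nhdsGT_zero.comp hr').const_mul_atTop (by positivity)
  have hsq : ∀ n, 2 / (√2 / r n) ^ 2 = r n ^ 2 := fun n => by
    rw [div_pow, Real.sq_sqrt (by norm_num), div_div_cancel₀ two_ne_zero]
  have herr : Tendsto (fun n : ℕ => ENNReal.ofReal
      (245 / 2 * (Real.exp (-((n : ℝ) * π * τ n ^ 2)) / r n ^ 2) +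
        (1 + 120 * π / c * Real.log (√2 / r n)) ^ 3 * r n ^ 2)) atTop (𝓝 0) := by
    have h1 := (IterLoc.tendsto_one_add_log_pow_three_div_sq (120 * π / c)).comp hy
    simp only [Function.comp_def, hsq] at h1
    simpa using ENNReal.tendsto_ofReal ((hexp.const_mul (245 / 2)).add h1)
  have hLc : ∀ᶠ n in atTop, 6 * π * Real.log (√2 / r n) * r n ^ 2 ≤ c := by
    have h1 := (((IterLoc.tendsto_log_pow_div_sq 1).const_mul (12 * π)).comp hy)
    rw [mul_zero] at h1
    filter_upwards [h1.eventually_le_const hc] with n hn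
    rw [← hsq]
    simp only [Function.comp_def, pow_one] at hn
    refine le_of_eq_of_le ?_ hn
    ring
  have hle : ∀ᶠ n : ℕ in atTop,
      IterLoc.networkLaw n (m n) {ω | IterLoc.AllLocalized (r n + 2 * τ n) ω}ᶜ ≤
        ENNReal.ofReal (245 / 2 * (Real.exp (-((n : ℝ) * π * τ n ^ 2)) / r n ^ 2) +
          (1 + 120 * π / c * Real.log (√2 / r n)) ^ 3 * r n ^ 2) := by
    filter_upwards [hr, hτ, hq, hLc, hr0.eventually_le_const (by norm_num : (0 : ℝ) < 1 / 50),
      hy.eventually_gt_atTop 1, hexp.eventually_le_const one_pos] with n h1 h2 h3 h4 h5 h6 h7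
    have hL := Real.log_pos h6
    refine IterLoc.networkLaw_not_allLocalized_le_of_small hc h1 h2.1 h2.2 h5 hL
      (IterLoc.lt_anchors hc hL ?_ h3) h4
    have hτr : τ n ≤ r n := h2.2.le.trans (div_le_self h1.le (by
      have : 1 ≤ √2 := Real.one_le_sqrt.2 (by norm_num)
      linarith))
    calc Real.exp (-((n : ℝ) * π * r n ^ 2)) ≤ Real.exp (-((n : ℝ) * π * τ n ^ 2)) := by
          have := h2.1.le
          gcongr
      _ ≤ r n ^ 2 := by rwa [div_le_one (by positivity)] at h7
      _ ≤ (1 / 50) ^ 2 := pow_le_pow_left₀ h1.le h5 2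
      _ ≤ 1 / 2 := by norm_num
  have hlow := ENNReal.Tendsto.sub (tendsto_const_nhds (x := (1 : ENNReal))) herr
    (Or.inl ENNReal.one_ne_top)
  rw [tsub_zero] at hlow
  refine tendsto_of_tendsto_of_tendsto_of_le_of_le' hlow tendsto_const_nhds ?_
    (.of_forall fun n => prob_le_one)
  filter_upwards [hle] with n hn
  refine tsub_le_iff_right.2 ?_
  calc (1 : ENNReal) = IterLoc.networkLaw n (m n) Set.univ := measure_univ.symm
    _ ≤ _ := by
        rw [← Set.union_compl_self {ω | IterLoc.AllLocalized (r n + 2 * τ n) ω}]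
        exact (measure_union_le _ _).trans (add_le_add le_rfl hn)
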